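/- For an integer $n\ge 1$ let $\mu(n)=\frac{\pi}{6}\sqrt{24n-1}$. For an integer $n\ge 2$ put $x=\mu(n-1)$, $y=\mu(n)$, $z=\mu(n+1)$ and define $$f(n)=e^{x-2y+z}\,\frac{(x^{10}-x^9-1)\,y^{24}\,(z^{10}-z^9-1)}{x^{12}\,(y^{10}-y^9+1)^2\,z^{12}},\qquad g(n)=e^{x-2y+z}\,\frac{(x^{10}-x^9+1)\,y^{24}\,(z^{10}-z^9+1)}{x^{12}\,(y^{10}-y^9-1)^2\,z^{12}}.$$ Then for every integer $n\ge 2$, $$g(n+1)<f(n)+\frac{110}{\mu(n-1)^5}.$$ -/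

import Mathlib

/-!
Put `φ w = w + log (w - 1) - 3 log w`. Both `log (f n)` and `log (g n)` are the second difference of
`φ ∘ μ` at `n - 1`, up to an error `O(μ(n-1)⁻⁵)`, so `log (g (n + 1)) - log (f n)` is a third
difference of `φ ∘ μ` up to such an error. As `μ(n)²` is an arithmetic progression of step
`2π²/3`, these are differences of `s ↦ φ √s`. That function is concave for `s > 1`, and for
`√s ≥ 5/2` its third derivative is at most `3 / (8 s ^ (5/2))`, that of `√s`. Hence
`log (g (n + 1))` is at most slightly positive and exceeds `log (f n)` by at most
`(π⁶/9 + 4/5) / μ(n-1)⁵`, where `π⁶/9 < 107`.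
-/

namespace PartitionBounds

noncomputable section

/-- `μ(n) = (π / 6) √(24 n - 1)`; the subtraction is that of the real numbers. -/
def mu (n : ℕ) : ℝ :=
  Real.pi / 6 * √(24 * (n : ℝ) - 1)

/-- The lower bound `f(n)`, with `x = μ(n-1)`, `y = μ(n)`, `z = μ(n+1)`. It is used for `n ≥ 2`
only, where the index `n - 1` is an honest natural number. -/
def f (n : ℕ) : ℝ :=
  let x := mu (n - 1)
  let y := mu n
  let z := mu (n + 1)
  Real.exp (x - 2 * y + z) *
    (((x ^ 10 - x ^ 9 - 1) * y ^ 24 * (z ^ 10 - z ^ 9 - 1)) /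
      (x ^ 12 * (y ^ 10 - y ^ 9 + 1) ^ 2 * z ^ 12))

/-- The upper bound `g(n)`, with `x = μ(n-1)`, `y = μ(n)`, `z = μ(n+1)`. It is used for `n ≥ 2`
only, where the index `n - 1` is an honest natural number. -/
def g (n : ℕ) : ℝ :=
  let x := mu (n - 1)
  let y := mu n
  let z := mu (n + 1)
  Real.exp (x - 2 * y + z) *
    (((x ^ 10 - x ^ 9 + 1) * y ^ 24 * (z ^ 10 - z ^ 9 + 1)) /
      (x ^ 12 * (y ^ 10 - y ^ 9 - 1) ^ 2 * z ^ 12))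

end

end PartitionBounds

namespace PartitionBounds

open Real Set fwdDiff

section ForwardDifference

lemma fwdDiff_iter_two_apply {M R : Type*} [AddCommMonoid M] [Ring R] (h : M) (u : M → R) (x : M) :
    (Δ_[h])^[2] u x = u (x + h + h) - 2 * u (x + h) + u x := by
  simp only [Function.iterate_succ_apply, Function.iterate_zero_apply, fwdDiff]
  noncomm_ring

lemma fwdDiff_le_mul_of_hasDerivAt_le {f f' : ℝ → ℝ} {a h C : ℝ} (hh : 0 ≤ h)
    (hf : ∀ s ∈ Icc a (a + h), HasDerivAt f (f' s) s) (hC : ∀ s ∈ Icc a (a + h), f' s ≤ C) :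
    Δ_[h] f a ≤ C * h := by
  have hah : a ≤ a + h := by linarith
  have hmvt := (convex_Icc a (a + h)).image_sub_le_mul_sub_of_deriv_le
    (fun s hs ↦ (hf s hs).continuousAt.continuousWithinAt)
    (fun s hs ↦ (hf s (interior_subset hs)).differentiableAt.differentiableWithinAt)
    (fun s hs ↦ (hf s (interior_subset hs)).deriv.trans_le (hC s (interior_subset hs)))
    a (left_mem_Icc.2 hah) (a + h) (right_mem_Icc.2 hah) hah
  rwa [add_sub_cancel_left] at hmvt

lemma fwdDiff_iter_le_mul_pow_of_hasDerivAt_le {n : ℕ} {F : ℕ → ℝ → ℝ} {a h C : ℝ} (hh : 0 ≤ h)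
    (hF : ∀ k < n, ∀ s ∈ Icc a (a + n * h), HasDerivAt (F k) (F (k + 1) s) s)
    (hC : ∀ s ∈ Icc a (a + n * h), F n s ≤ C) :
    (Δ_[h])^[n] (F 0) a ≤ C * h ^ n := by
  induction n generalizing F C with
  | zero => simpa using hC a (by simp)
  | succ n ih =>
    push_cast at hF hC
    have Icc_subset {s : ℝ} (hs : s ∈ Icc a (a + n * h)) :
        Icc s (s + h) ⊆ Icc a (a + (n + 1) * h) :=
      Icc_subset_Icc hs.1 (by linarith [hs.2])
    have left_mem {s : ℝ} (hs : s ∈ Icc a (a + n * h)) : s ∈ Icc a (a + (n + 1) * h) :=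
      Icc_subset hs (left_mem_Icc.2 (by linarith))
    have right_mem {s : ℝ} (hs : s ∈ Icc a (a + n * h)) : s + h ∈ Icc a (a + (n + 1) * h) :=
      Icc_subset hs (right_mem_Icc.2 (by linarith))
    rw [Function.iterate_succ_apply, pow_succ', ← mul_assoc]
    refine ih (F := fun k ↦ Δ_[h] (F k)) (fun k hk s hs ↦ ?_) fun s hs ↦ ?_
    · exact ((hF k (by lia) _ (right_mem hs)).comp_add_const s h).sub
        (hF k (by lia) s (left_mem hs))
    · exact fwdDiff_le_mul_of_hasDerivAt_le hh
        (fun t ht ↦ hF n n.lt_succ_self t (Icc_subset hs ht)) fun t ht ↦ hC t (Icc_subset hs ht)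

end ForwardDifference

section LogMainTerm

/-- The logarithm of the main term `e ^ w (w - 1) / w ^ 3` of the partition function, up to a
constant factor, at `w = μ(n)`. -/
noncomputable def logMainTerm (w : ℝ) : ℝ :=
  w + log (w - 1) - 3 * log w

/-- For `k ≤ 3`, the `k`-th derivative of `s ↦ logMainTerm √s`, as a function of `w = √s`; each is
`1 / (2 w)` times the derivative of the previous one. The value at `k > 3` is arbitrary. -/
noncomputable def logMainTermDeriv : ℕ → ℝ → ℝ
  | 0, w => logMainTerm w
  | 1, w => (1 / (w - 1) - 3 / w ^ 2) / 2
  | 2, w => (6 / w ^ 4 - 1 / (w * (w - 1) ^ 2)) / 4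
  | _, w => ((3 * w - 1) / (w ^ 3 * (w - 1) ^ 3) - 24 / w ^ 6) / 8

lemma hasDerivAt_logMainTermDeriv {k : ℕ} (hk : k < 3) {w : ℝ} (hw : 1 < w) :
    HasDerivAt (logMainTermDeriv k) (2 * w * logMainTermDeriv (k + 1) w) w := by
  have hw₀ : w ≠ 0 := by positivity
  have hw₁ : w - 1 ≠ 0 := by linarith
  have hsub : HasDerivAt (fun w : ℝ ↦ w - 1) 1 w := (hasDerivAt_id w).sub_const 1
  interval_cases k
  · refine (((hasDerivAt_id w).add (hsub.log hw₁)).sub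
      ((hasDerivAt_log hw₀).const_mul 3)).congr_deriv ?_
    simp only [logMainTermDeriv]
    field_simp
    ring
  · refine ((((hasDerivAt_const w 1).div hsub hw₁).sub ((hasDerivAt_const w 3).div
      (hasDerivAt_pow 2 w) (by positivity))).div_const 2).congr_deriv ?_
    simp only [logMainTermDeriv]
    field_simp
    ring
  · refine ((((hasDerivAt_const w 6).div (hasDerivAt_pow 4 w) (by positivity)).sub
      ((hasDerivAt_const w 1).div ((hasDerivAt_id w).mul (hsub.pow 2))
        (by simp [hw₀, hw₁]))).div_const 4).congr_deriv ?_
    simp only [logMainTermDeriv, Pi.mul_apply, Pi.pow_apply, id]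
    field_simp
    ring

lemma hasDerivAt_logMainTermDeriv_sqrt {k : ℕ} (hk : k < 3) {s : ℝ} (hs : 1 < s) :
    HasDerivAt (fun s ↦ logMainTermDeriv k √s) (logMainTermDeriv (k + 1) √s) s := by
  have hw : 1 < √s := lt_sqrt_of_sq_lt (by linarith)
  refine ((hasDerivAt_logMainTermDeriv hk hw).comp s
    (hasDerivAt_sqrt (by positivity))).congr_deriv ?_
  field_simp

lemma logMainTermDeriv_two_nonpos {w : ℝ} (hw : 1 < w) : logMainTermDeriv 2 w ≤ 0 := by
  have : 0 < w - 1 := by linarith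
  have hnum : 6 * (w - 1) ^ 2 ≤ w ^ 3 := by
    have hcube : (-1) ^ 3 ≤ (w - 2) ^ 3 := (Odd.pow_le_pow (by decide)).2 (by linarith)
    calc 6 * (w - 1) ^ 2 = w ^ 3 - ((w - 2) ^ 3 + 2) := by ring
      _ ≤ w ^ 3 := by linarith
  have hle : 6 / w ^ 4 ≤ 1 / (w * (w - 1) ^ 2) := by
    rw [div_le_div_iff₀ (by positivity) (by positivity)]
    calc 6 * (w * (w - 1) ^ 2) = w * (6 * (w - 1) ^ 2) := by ring
      _ ≤ w * w ^ 3 := by gcongr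
      _ = 1 * w ^ 4 := by ring
  simp only [logMainTermDeriv]
  linarith

lemma logMainTermDeriv_three_le {w : ℝ} (hw : 5 / 2 ≤ w) :
    logMainTermDeriv 3 w ≤ 3 / 8 / w ^ 5 := by
  have hw₁ : 0 < w - 1 := by linarith
  have hnum : w ^ 3 * (3 * w - 1) ≤ (3 * w + 24) * (w - 1) ^ 3 := by
    obtain ⟨v, rfl⟩ : ∃ v, w = v + 5 / 2 := ⟨w - 5 / 2, by ring⟩
    have hv : 0 ≤ v := by linarith
    have hpos : 0 ≤ 16 * v ^ 3 + 57 * v ^ 2 + 54 * v + 19 / 4 := by positivity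
    linear_combination hpos
  have hle : (3 * w - 1) / (w ^ 3 * (w - 1) ^ 3) ≤ (3 * w + 24) / w ^ 6 := by
    rw [div_le_div_iff₀ (by positivity) (by positivity)]
    calc (3 * w - 1) * w ^ 6 = w ^ 3 * (w ^ 3 * (3 * w - 1)) := by ring
      _ ≤ w ^ 3 * ((3 * w + 24) * (w - 1) ^ 3) := by gcongr
      _ = (3 * w + 24) * (w ^ 3 * (w - 1) ^ 3) := by ring
  calc logMainTermDeriv 3 w ≤ ((3 * w + 24) / w ^ 6 - 24 / w ^ 6) / 8 := by
        simp only [logMainTermDeriv]; gcongr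
    _ = 3 / 8 / w ^ 5 := by field_simp; ring

lemma fwdDiff_iter_two_logMainTerm_sqrt_nonpos {s h : ℝ} (hs : 1 < s) (hh : 0 ≤ h) :
    (Δ_[h])^[2] (fun s ↦ logMainTerm √s) s ≤ 0 := by
  have hdiff := fwdDiff_iter_le_mul_pow_of_hasDerivAt_le (n := 2) (C := 0) hh
    (F := fun k s ↦ logMainTermDeriv k √s)
    (fun k hk t ht ↦ hasDerivAt_logMainTermDeriv_sqrt (by lia) (hs.trans_le ht.1))
    fun t ht ↦ logMainTermDeriv_two_nonpos (lt_sqrt_of_sq_lt (by linarith [ht.1]))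
  rwa [zero_mul] at hdiff

lemma fwdDiff_iter_three_logMainTerm_sqrt_le {w h : ℝ} (hw : 5 / 2 ≤ w) (hh : 0 ≤ h) :
    (Δ_[h])^[3] (fun s ↦ logMainTerm √s) (w ^ 2) ≤ 3 / 8 / w ^ 5 * h ^ 3 := by
  refine fwdDiff_iter_le_mul_pow_of_hasDerivAt_le (F := fun k s ↦ logMainTermDeriv k √s) hh
    (fun k hk t ht ↦ hasDerivAt_logMainTermDeriv_sqrt hk (by nlinarith [ht.1])) fun t ht ↦ ?_
  have hwt : w ≤ √t := le_sqrt_of_sq_le ht.1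
  calc logMainTermDeriv 3 √t ≤ 3 / 8 / √t ^ 5 := logMainTermDeriv_three_le (hw.trans hwt)
    _ ≤ 3 / 8 / w ^ 5 := by gcongr

end LogMainTerm

section MainTerm

/-- The main term `e ^ w (w ^ 10 - w ^ 9) / w ^ 12` of the partition function at `w = μ(n)`, with
its polynomial factor shifted by `ε`. The quotients `f` and `g` are made of its values at
`ε = 1` and `ε = -1`. -/
noncomputable def mainTerm (ε w : ℝ) : ℝ :=
  exp w * (w ^ 10 - w ^ 9 + ε) / w ^ 12

lemma f_eq_mainTerm_div (n : ℕ) :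
    f n = mainTerm (-1) (mu (n - 1)) * mainTerm (-1) (mu (n + 1)) / mainTerm 1 (mu n) ^ 2 := by
  simp only [f, mainTerm, exp_add, exp_sub, two_mul, div_eq_mul_inv, mul_inv, mul_pow, inv_pow,
    inv_inv]
  ring

lemma g_eq_mainTerm_div (n : ℕ) :
    g n = mainTerm 1 (mu (n - 1)) * mainTerm 1 (mu (n + 1)) / mainTerm (-1) (mu n) ^ 2 := by
  simp only [g, mainTerm, exp_add, exp_sub, two_mul, div_eq_mul_inv, mul_inv, mul_pow, inv_pow,
    inv_inv]
  ring

lemma mainTerm_eq_exp_mul (ε : ℝ) {w : ℝ} (hw : 1 < w) :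
    mainTerm ε w = exp (logMainTerm w) * (1 + ε / (w ^ 9 * (w - 1))) := by
  have hw₁ : 0 < w - 1 := by linarith
  have hlog : 3 * log w = log (w ^ 3) := by simp
  rw [mainTerm, logMainTerm, hlog, exp_sub, exp_add, exp_log hw₁, exp_log (by positivity)]
  field_simp

lemma mainTerm_one_pos {w : ℝ} (hw : 1 < w) : 0 < mainTerm 1 w := by
  have : 0 < w - 1 := by linarith
  rw [mainTerm_eq_exp_mul 1 hw]
  positivity

lemma ten_mul_pow_five_add_one_le {w : ℝ} (hw : 2 ≤ w) : 10 * w ^ 5 + 1 ≤ w ^ 9 * (w - 1) := by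
  have hw₅ : (2 : ℝ) ^ 5 ≤ w ^ 5 := by gcongr
  calc 10 * w ^ 5 + 1 ≤ w ^ 5 * (2 ^ 4 * (2 - 1)) := by linarith
    _ ≤ w ^ 5 * (w ^ 4 * (w - 1)) := by gcongr
    _ = w ^ 9 * (w - 1) := by ring

lemma mainTerm_one_le_exp {a w : ℝ} (ha : 2 ≤ a) (hw : a ≤ w) :
    mainTerm 1 w ≤ exp (logMainTerm w + 1 / (10 * a ^ 5)) := by
  have hm : 10 * a ^ 5 ≤ w ^ 9 * (w - 1) := by
    have : a ^ 5 ≤ w ^ 5 := by gcongr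
    linarith [ten_mul_pow_five_add_one_le (ha.trans hw)]
  rw [mainTerm_eq_exp_mul 1 (by linarith), exp_add]
  gcongr
  calc 1 + 1 / (w ^ 9 * (w - 1)) ≤ 1 / (10 * a ^ 5) + 1 := by rw [add_comm]; gcongr
    _ ≤ exp (1 / (10 * a ^ 5)) := add_one_le_exp _

lemma exp_le_mainTerm_neg_one {a w : ℝ} (ha : 2 ≤ a) (hw : a ≤ w) :
    exp (logMainTerm w - 1 / (10 * a ^ 5)) ≤ mainTerm (-1) w := by
  have hm : 10 * a ^ 5 + 1 ≤ w ^ 9 * (w - 1) := by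
    have : a ^ 5 ≤ w ^ 5 := by gcongr
    linarith [ten_mul_pow_five_add_one_le (ha.trans hw)]
  have hexp : exp (-(1 / (10 * a ^ 5))) ≤ 1 - 1 / (10 * a ^ 5 + 1) := by
    rw [exp_neg]
    calc (exp (1 / (10 * a ^ 5)))⁻¹ ≤ (1 / (10 * a ^ 5) + 1)⁻¹ := by
          gcongr; exact add_one_le_exp _
      _ = 1 - 1 / (10 * a ^ 5 + 1) := by field_simp; ring
  rw [mainTerm_eq_exp_mul (-1) (by linarith), sub_eq_add_neg, exp_add, neg_div, ← sub_eq_add_neg]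
  gcongr
  exact hexp.trans (by gcongr)

end MainTerm

section Mu

lemma mu_sq {n : ℕ} (hn : 1 ≤ n) : mu n ^ 2 = π ^ 2 / 36 * (24 * n - 1) := by
  have : (1 : ℝ) ≤ n := mod_cast hn
  rw [mu, mul_pow, sq_sqrt (by linarith)]
  ring

lemma mu_succ_sq {n : ℕ} (hn : 1 ≤ n) : mu (n + 1) ^ 2 = mu n ^ 2 + 2 * π ^ 2 / 3 := by
  rw [mu_sq hn, mu_sq (by lia)]
  push_cast
  ring

lemma mu_monotone : Monotone mu := fun m n hmn ↦ by
  unfold mu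
  gcongr

lemma five_halves_le_mu {n : ℕ} (hn : 1 ≤ n) : 5 / 2 ≤ mu n := by
  have hn' : (1 : ℝ) ≤ n := mod_cast hn
  refine le_of_sq_le_sq ?_ (by unfold mu; positivity)
  calc ((5 : ℝ) / 2) ^ 2 ≤ 3.14 ^ 2 / 36 * (24 * 1 - 1) := by norm_num
    _ ≤ π ^ 2 / 36 * (24 * n - 1) := by gcongr; exact pi_gt_d2.le
    _ = mu n ^ 2 := (mu_sq hn).symm

lemma fwdDiff_iter_logMainTerm_mu (k : ℕ) {n : ℕ} (hn : 1 ≤ n) :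
    (Δ_[1])^[k] (logMainTerm ∘ mu) n
      = (Δ_[2 * π ^ 2 / 3])^[k] (fun s ↦ logMainTerm √s) (mu n ^ 2) := by
  induction k generalizing n with
  | zero => simp [sqrt_sq (show 0 ≤ mu n by linarith [five_halves_le_mu hn])]
  | succ k ih =>
    simp only [Function.iterate_succ_apply', fwdDiff]
    rw [ih hn, ih (by lia), mu_succ_sq hn]

lemma fwdDiff_iter_two_logMainTerm_mu_nonpos {n : ℕ} (hn : 1 ≤ n) :
    (Δ_[1])^[2] (logMainTerm ∘ mu) n ≤ 0 := by
  rw [fwdDiff_iter_logMainTerm_mu 2 hn]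
  exact fwdDiff_iter_two_logMainTerm_sqrt_nonpos (by nlinarith [five_halves_le_mu hn])
    (by positivity)

lemma fwdDiff_iter_three_logMainTerm_mu_le {n : ℕ} (hn : 1 ≤ n) :
    (Δ_[1])^[3] (logMainTerm ∘ mu) n ≤ π ^ 6 / 9 / mu n ^ 5 := by
  rw [fwdDiff_iter_logMainTerm_mu 3 hn]
  refine (fwdDiff_iter_three_logMainTerm_sqrt_le (five_halves_le_mu hn) (by positivity)).trans_eq ?_
  ring

end Mu

lemma exp_fwdDiff_sub_le_f {n : ℕ} (hn : 1 ≤ n) :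
    exp ((Δ_[1])^[2] (logMainTerm ∘ mu) n - 2 / 5 / mu n ^ 5) ≤ f (n + 1) := by
  have hmu : 2 ≤ mu n := by linarith [five_halves_le_mu hn]
  have h₁ : mu n ≤ mu (n + 1) := mu_monotone (by lia)
  have h₂ : mu n ≤ mu (n + 2) := mu_monotone (by lia)
  set η := 1 / (10 * mu n ^ 5) with hη
  calc exp ((Δ_[1])^[2] (logMainTerm ∘ mu) n - 2 / 5 / mu n ^ 5)
      = exp (logMainTerm (mu n) - η) * exp (logMainTerm (mu (n + 2)) - η)
          / exp (logMainTerm (mu (n + 1)) + η) ^ 2 := by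
        rw [← exp_add, ← exp_nat_mul, ← exp_sub, fwdDiff_iter_two_apply, hη]
        simp only [Function.comp_apply]
        push_cast
        ring_nf
    _ ≤ mainTerm (-1) (mu n) * mainTerm (-1) (mu (n + 2)) / mainTerm 1 (mu (n + 1)) ^ 2 := by
        have hpos := mainTerm_one_pos (w := mu (n + 1)) (by linarith)
        have hx := exp_le_mainTerm_neg_one hmu le_rfl
        have hy := mainTerm_one_le_exp hmu h₁
        have hz := exp_le_mainTerm_neg_one hmu h₂
        have hx_pos := (exp_pos _).trans_le hx
        have hz_pos := (exp_pos _).trans_le hz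
        gcongr
    _ = f (n + 1) := (f_eq_mainTerm_div (n + 1)).symm

lemma g_le_exp_fwdDiff_add {n : ℕ} (hn : 1 ≤ n) :
    g (n + 1) ≤ exp ((Δ_[1])^[2] (logMainTerm ∘ mu) n + 2 / 5 / mu n ^ 5) := by
  have hmu : 2 ≤ mu n := by linarith [five_halves_le_mu hn]
  have h₁ : mu n ≤ mu (n + 1) := mu_monotone (by lia)
  have h₂ : mu n ≤ mu (n + 2) := mu_monotone (by lia)
  set η := 1 / (10 * mu n ^ 5) with hη
  calc g (n + 1)
      = mainTerm 1 (mu n) * mainTerm 1 (mu (n + 2)) / mainTerm (-1) (mu (n + 1)) ^ 2 :=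
        g_eq_mainTerm_div (n + 1)
    _ ≤ exp (logMainTerm (mu n) + η) * exp (logMainTerm (mu (n + 2)) + η)
          / exp (logMainTerm (mu (n + 1)) - η) ^ 2 := by
        have hpos := mainTerm_one_pos (w := mu (n + 2)) (by linarith)
        have hx := mainTerm_one_le_exp hmu le_rfl
        have hy := exp_le_mainTerm_neg_one hmu h₁
        have hz := mainTerm_one_le_exp hmu h₂
        gcongr
    _ = exp ((Δ_[1])^[2] (logMainTerm ∘ mu) n + 2 / 5 / mu n ^ 5) := by
        rw [← exp_add, ← exp_nat_mul, ← exp_sub, fwdDiff_iter_two_apply, hη]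
        simp only [Function.comp_apply]
        push_cast
        ring_nf

lemma exp_sub_exp_le (x y : ℝ) : exp x - exp y ≤ exp x * (x - y) := by
  have hexp : exp x * (y - x + 1) ≤ exp y := by
    calc exp x * (y - x + 1) ≤ exp x * exp (y - x) := by gcongr; exact add_one_le_exp _
      _ = exp y := by rw [← exp_add, add_sub_cancel]
  linarith

lemma exp_lt_exp_add_of_sub_le {x y u : ℝ} (hu : 0 < u) (hx : x ≤ 1 / 200)
    (hxy : x - y ≤ (π ^ 6 / 9 + 4 / 5) * u) : exp x < exp y + 110 * u := by
  have hexp : exp x ≤ 200 / 199 :=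
    calc exp x ≤ exp (1 / 200) := by gcongr
      _ ≤ 1 / (1 - 1 / 200) := exp_bound_div_one_sub_of_interval (by norm_num) (by norm_num)
      _ = 200 / 199 := by norm_num
  have hpi : π ^ 6 ≤ 3.1416 ^ 6 := by gcongr; exact pi_lt_d4.le
  have hmul : exp x * (x - y) < 110 * u :=
    calc exp x * (x - y) ≤ exp x * ((π ^ 6 / 9 + 4 / 5) * u) := by gcongr
      _ ≤ 200 / 199 * ((3.1416 ^ 6 / 9 + 4 / 5) * u) := by gcongr
      _ < 110 * u := by rw [← mul_assoc]; gcongr; norm_num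
  linarith [exp_sub_exp_le x y]

end PartitionBounds

open PartitionBounds fwdDiff

theorem mainTheorem5 (n : ℕ) (hn : 2 ≤ n) :
    PartitionBounds.g (n + 1) <
      PartitionBounds.f n + 110 / PartitionBounds.mu (n - 1) ^ 5 := by
  obtain ⟨m, rfl⟩ : ∃ m, n = m + 1 := ⟨n - 1, by lia⟩
  have hm : 1 ≤ m := by lia
  rw [Nat.add_sub_cancel, ← mul_one_div]
  set D : ℕ → ℝ := (Δ_[1])^[2] (logMainTerm ∘ mu)
  have hmu : 5 / 2 ≤ mu m := five_halves_le_mu hm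
  have hf : Real.exp (D m - 2 / 5 / mu m ^ 5) ≤ f (m + 1) := exp_fwdDiff_sub_le_f hm
  have hg : g (m + 1 + 1) ≤ Real.exp (D (m + 1) + 2 / 5 / mu m ^ 5) := by
    refine (g_le_exp_fwdDiff_add (by lia)).trans ?_
    gcongr
    exact mu_monotone m.le_succ
  have hsecond : D (m + 1) ≤ 0 := fwdDiff_iter_two_logMainTerm_mu_nonpos (by lia)
  have hthird : D (m + 1) - D m ≤ Real.pi ^ 6 / 9 / mu m ^ 5 :=
    fwdDiff_iter_three_logMainTerm_mu_le hm
  have herror : 2 / 5 / mu m ^ 5 ≤ 1 / 200 := by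
    calc 2 / 5 / mu m ^ 5 ≤ 2 / 5 / (5 / 2) ^ 5 := by gcongr
      _ ≤ 1 / 200 := by norm_num
  have hexp := exp_lt_exp_add_of_sub_le (x := D (m + 1) + 2 / 5 / mu m ^ 5)
    (y := D m - 2 / 5 / mu m ^ 5) (u := 1 / mu m ^ 5) (by positivity) (by linarith)
    (by linear_combination hthird)
  linarith
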